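/- An effect algebra is a set $E$ with elements $0,1$ and a partial binary operation $+$ such that: (E1) if $a+b$ is defined, so is $b+a$, and they are equal; (E2) if $a+b$ and $(a+b)+c$ are defined, then $b+c$ and $a+(b+c)$ are defined and $(a+b)+c=a+(b+c)$; (E3) for each $a$ there is a unique $a'$ with $a+a'=1$; (E4) if $a+1$ is defined, then $a=0$. It is ordered by $a\le b$ iff $c+a=b$ for some $c$; an atom is a minimal nonzero element, and $E$ is atomic if below every nonzero element there is an atom. For $e\in E$, the interval $E[0,e]=\{x\in E: x\le e\}$ is an effect algebra with unit $e$, in which $x+y$ is defined iff $x+y$ is defined in $E$ and $x+y\le e$. A product of effect algebras carries the coordinatewise operations. $E$ has the Riesz decomposition property (RDP) if $a_1+a_2=b_1+b_2$ implies that there are $c_{ij}\in E$ $(i,j\in\{1,2\})$ with $a_i=c_{i1}+c_{i2}$ and $b_j=c_{1j}+c_{2j}$. A family in $E$ is orthogonal if the sum of each of its finite subfamilies is defined; its sum $\sum$ is then the supremum, if this exists, of the sums of its finite subfamilies. $E$ is orthocomplete if every orthogonal family has a sum. The isotropic index of $a$ is the greatest $n\ge 0$ for which $na=a+\cdots+a$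 ($n$ terms) is defined ($+\infty$ if there is no greatest). An element $z$ is central if (a) for $e=z$ and for $e=z'$, $a,b\le e$ implies $a+b\le e$ whenever $a+b$ is defined, and (b) each $p\in E$ is $q+r$ with $q\le z$, $r\le z'$. The set $C(E)$ of central elements, with the order of $E$, is a Boolean algebra. $E$ is an MV-effect algebra if it is a lattice and any $a,b\in E$ are compatible, i.e. $a=a_1+c$, $b=b_1+c$ for some $a_1,b_1,c\in E$ with $a_1+b_1+c$ defined; it is complete if every subset has a supremum and an infimum. **Theorem.** Let $E$ be an orthocomplete atomic effect algebra with RDP, and let $A(E)=\{a_i\mid i\in I\}$ be the set of all atoms of $E$, indexed without repetition and of arbitrary cardinality. Then every $a_i$ has a finite isotropic index $\imath_i$, and: (i) for every $i\in I$, the element $\imath_i a_i$ is central; (ii) for every $i\in I$, the element $\imath_i a_i$ is an atom of the Boolean algebra $C(E)$; (iii) for every $y\in E$, the meets $y\wedge \imath_i a_i$ $(i\in I)$ exist in $E$, they form an orthogonal family, and $y=\sum_{i\in I}(y\wedge \imath_i a_i)$; (iv) $E$ is isomorphic, as an effect algebra, to $\prod_{i\in I}E[0,\imath_i a_i]$;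 (v) $E$ is a complete MV-effect algebra. -/

import Mathlib

universe u v

/-- An effect algebra `(E; +, 0, 1)`. The partial binary operation `+` is given by its graph:
`Adds a b c` says that `a + b` is defined and equals `c`. -/
class EffectAlgebra (E : Type u) extends Zero E, One E where
  Adds : E → E → E → Prop
  /-- the value of `a + b` is unique where it is defined -/
  adds_unique : ∀ {a b c d : E}, Adds a b c → Adds a b d → c = d
  adds_comm : ∀ {a b c : E}, Adds a b c → Adds b a c
  adds_assoc : ∀ {a b c ab abc : E}, Adds a b ab → Adds ab c abc →
    ∃ bc, Adds b c bc ∧ Adds a bc abc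
  exists_unique_orthosupplement : ∀ a : E, ∃! b, Adds a b 1
  eq_zero_of_adds_one : ∀ {a c : E}, Adds a 1 c → a = 0

namespace EffectAlgebra

section Basic

variable {E : Type u} [EffectAlgebra E]

theorem adds_zero (a : E) : Adds a 0 a := by
  have h1 : Adds (1 : E) 0 1 := by
    obtain ⟨b, hb, -⟩ := exists_unique_orthosupplement (1 : E)
    have hb0 := eq_zero_of_adds_one (adds_comm hb)
    simpa [hb0] using hb
  obtain ⟨b, hb, -⟩ := exists_unique_orthosupplement a
  obtain ⟨x, hx, hbx⟩ := adds_assoc (adds_comm hb) h1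
  obtain ⟨c, -, hu⟩ := exists_unique_orthosupplement b
  have : x = a := (hu x hbx).trans (hu a (adds_comm hb)).symm
  simpa [this] using hx

theorem zero_adds (a : E) : Adds 0 a a := adds_comm (adds_zero a)

theorem adds_cancel {a b c x : E} (hb : Adds a b x) (hc : Adds a c x) : b = c := by
  obtain ⟨x', hx, -⟩ := exists_unique_orthosupplement x
  obtain ⟨y, hy, hby⟩ := adds_assoc (adds_comm hb) hx
  obtain ⟨z, hz, hcz⟩ := adds_assoc (adds_comm hc) hx
  obtain rfl := adds_unique hy hz
  obtain ⟨w, -, hu⟩ := exists_unique_orthosupplement y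
  exact (hu b (adds_comm hby)).trans (hu c (adds_comm hcz)).symm

theorem eq_zero_of_adds_zero {a b : E} (h : Adds a b 0) : a = 0 := by
  obtain ⟨x, hx, -⟩ := adds_assoc (adds_comm h) (zero_adds (1 : E))
  exact eq_zero_of_adds_one hx

/-- The canonical order: `a ≤ b` iff `c + a = b` for some `c`. -/
instance instPartialOrder : PartialOrder E where
  le a b := ∃ c, Adds c a b
  le_refl a := ⟨0, zero_adds a⟩
  le_trans a b e := by
    rintro ⟨c, hc⟩ ⟨d, hd⟩
    obtain ⟨f, -, hf⟩ := adds_assoc (adds_comm hc) (adds_comm hd)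
    exact ⟨f, adds_comm hf⟩
  le_antisymm a b := by
    rintro ⟨c, hc⟩ ⟨d, hd⟩
    obtain ⟨f, hf, hf'⟩ := adds_assoc (adds_comm hc) (adds_comm hd)
    obtain rfl := adds_cancel hf' (adds_zero a)
    obtain rfl := eq_zero_of_adds_zero hf
    exact adds_unique (zero_adds a) hc

theorem le_def {a b : E} : a ≤ b ↔ ∃ c, Adds c a b := Iff.rfl

/-- `0` is the least and `1` the greatest element. -/
instance instBoundedOrder : BoundedOrder E where
  bot := 0
  bot_le a := ⟨a, adds_zero a⟩
  top := 1
  le_top a := by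
    obtain ⟨b, hb, -⟩ := exists_unique_orthosupplement a
    exact ⟨b, adds_comm hb⟩

/-- `IsMultiple a n x`: the multiple `n a` exists in `E` and equals `x`, where `0 a = 0` and
`(n + 1) a = n a + a`. -/
def IsMultiple (a : E) : ℕ → E → Prop
  | 0, x => x = 0
  | n + 1, x => ∃ y, IsMultiple a n y ∧ Adds y a x

/-- The isotropic index of `a`: the greatest `n` for which `n a` exists, and `⊤` if `n a` exists
for all `n`. -/
noncomputable def isotropicIndex (a : E) : ℕ∞ :=
  ⨆ n ∈ {n : ℕ | ∃ x, IsMultiple a n x}, (n : ℕ∞)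

/-- `IsSumOver a s x`: the finite subsystem `(a i)_{i ∈ s}` is orthogonal with sum `x`. -/
inductive IsSumOver {ι : Type v} (a : ι → E) : Finset ι → E → Prop
  | empty : IsSumOver a ∅ 0
  | cons {i : ι} {s : Finset ι} {x y : E} (hi : i ∉ s) :
      IsSumOver a s x → Adds x (a i) y → IsSumOver a (Finset.cons i s hi) y

/-- A system is orthogonal if all its finite subsystems are. -/
def IsOrthogonal {ι : Type v} (a : ι → E) : Prop :=
  ∀ s : Finset ι, ∃ x, IsSumOver a s x

/-- `x` is the sum of the orthogonal system `a`, that is, the supremum of the sums of its finite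
subsystems. -/
def IsSystemSum {ι : Type v} (a : ι → E) (x : E) : Prop :=
  IsOrthogonal a ∧ IsLUB {y : E | ∃ s : Finset ι, IsSumOver a s y} x

/-- `e` is principal: `a, b ≤ e` implies `a + b ≤ e` whenever `a + b` is defined. -/
def IsPrincipal (e : E) : Prop :=
  ∀ a b c : E, a ≤ e → b ≤ e → Adds a b c → c ≤ e

/-- `z` is central: `z` and its orthosupplement `z'` are principal, and each element is a sum of
an element below `z` and an element below `z'`. -/
def IsCentral (z : E) : Prop :=
  IsPrincipal z ∧ ∃ z' : E, Adds z z' 1 ∧ IsPrincipal z' ∧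
    ∀ p : E, ∃ q r : E, q ≤ z ∧ r ≤ z' ∧ Adds q r p

variable (E) in
/-- The center `C(E)`, with the order of `E`. -/
def center : Set E := {z | IsCentral z}

theorem zero_mem_center : (0 : E) ∈ center E := by
  refine ⟨?_, 1, zero_adds 1, fun a b c _ _ _ => le_top, fun p => ⟨0, p, le_rfl, le_top,
    zero_adds p⟩⟩
  intro a b c ha hb h
  have ha' : a = 0 := le_bot_iff.1 ha
  have hb' : b = 0 := le_bot_iff.1 hb
  subst ha' hb'
  exact (adds_unique h (zero_adds 0)).le

instance instOrderBotCenter : OrderBot (center E) where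
  bot := ⟨0, zero_mem_center⟩
  bot_le a := (bot_le : (⊥ : E) ≤ a.1)

/-- `a` and `b` are compatible: `a = a₁ + c`, `b = b₁ + c` with `a₁ + b₁ + c` defined. -/
def Compatible (a b : E) : Prop :=
  ∃ a₁ b₁ c : E, Adds a₁ c a ∧ Adds b₁ c b ∧ ∃ t s : E, Adds a₁ b₁ t ∧ Adds t c s

end Basic

section Properties

variable (E : Type u) [EffectAlgebra E]

/-- The Riesz decomposition property. -/
def RDP : Prop :=
  ∀ a₁ a₂ b₁ b₂ s : E, Adds a₁ a₂ s → Adds b₁ b₂ s →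
    ∃ c₁₁ c₁₂ c₂₁ c₂₂ : E, Adds c₁₁ c₁₂ a₁ ∧ Adds c₂₁ c₂₂ a₂ ∧ Adds c₁₁ c₂₁ b₁ ∧ Adds c₁₂ c₂₂ b₂

/-- Every orthogonal system has a sum. -/
def IsOrthocomplete : Prop :=
  ∀ (ι : Type u) (a : ι → E), IsOrthogonal a → ∃ x, IsSystemSum a x

/-- A lattice-ordered effect algebra in which any two elements are compatible. -/
def IsMVEffectAlgebra : Prop :=
  (∀ a b : E, (∃ x, IsLUB {a, b} x) ∧ ∃ x, IsGLB {a, b} x) ∧ ∀ a b : E, Compatible a b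

/-- An MV-effect algebra in which every subset has a supremum and an infimum. -/
def IsCompleteMVEffectAlgebra : Prop :=
  IsMVEffectAlgebra E ∧ ∀ S : Set E, (∃ x, IsLUB S x) ∧ ∃ x, IsGLB S x

end Properties

/-- The interval `E[0, e]`. -/
def Interval {E : Type u} [EffectAlgebra E] (e : E) : Type u := {x : E // x ≤ e}

/-- `E[0, e]` is an effect algebra with unit `e`; `x + y` is defined in it iff `x + y` is defined
in `E` and lies below `e`, and then the two sums agree. -/
instance instInterval {E : Type u} [EffectAlgebra E] (e : E) : EffectAlgebra (Interval e) where
  zero := ⟨0, bot_le⟩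
  one := ⟨e, le_rfl⟩
  Adds x y z := Adds x.1 y.1 z.1
  adds_unique h h' := Subtype.ext (adds_unique h h')
  adds_comm h := adds_comm h
  adds_assoc := by
    intro a b c ab abc h h'
    obtain ⟨x, hx, hx'⟩ := adds_assoc h h'
    exact ⟨⟨x, le_trans ⟨a.1, hx'⟩ abc.2⟩, hx, hx'⟩
  exists_unique_orthosupplement := by
    rintro ⟨a, c, hc⟩
    refine ⟨⟨c, a, adds_comm hc⟩, adds_comm hc, ?_⟩
    intro y hy
    exact Subtype.ext (adds_cancel hy (adds_comm hc))
  eq_zero_of_adds_one := by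
    intro a c h
    have hce : c.1 = e := le_antisymm c.2 ⟨a.1, h⟩
    have h' : Adds a.1 e c.1 := h
    rw [hce] at h'
    exact Subtype.ext (adds_cancel (adds_comm h') (adds_zero e))

/-- The Cartesian product of a family of effect algebras. -/
def Product {ι : Type v} (F : ι → Type u) : Type (max u v) := ∀ i, F i

/-- All operations of the product are coordinatewise; a sum is defined iff it is defined in each
coordinate. -/
instance instProduct {ι : Type v} (F : ι → Type u) [∀ i, EffectAlgebra (F i)] :
    EffectAlgebra (Product F) where
  zero := fun _ => 0
  one := fun _ => 1
  Adds x y z := ∀ i, Adds (x i) (y i) (z i)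
  adds_unique h h' := funext fun i => adds_unique (h i) (h' i)
  adds_comm h i := adds_comm (h i)
  adds_assoc h h' := by
    choose x hx hx' using fun i => adds_assoc (h i) (h' i)
    exact ⟨x, hx, hx'⟩
  exists_unique_orthosupplement a := by
    choose b hb hu using fun i => exists_unique_orthosupplement (a i)
    exact ⟨b, hb, fun y hy => funext fun i => hu i (y i) (hy i)⟩
  eq_zero_of_adds_one h := funext fun i => eq_zero_of_adds_one (h i)

/-- An isomorphism of effect algebras: a bijection which preserves `0` and `1` and such that
`a + b` is defined iff `f a + f b` is, with `f (a + b) = f a + f b`. -/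
structure Iso (E : Type u) (F : Type v) [EffectAlgebra E] [EffectAlgebra F] extends E ≃ F where
  map_zero : toFun 0 = 0
  map_one : toFun 1 = 1
  map_adds : ∀ a b c : E, Adds a b c ↔ Adds (toFun a) (toFun b) (toFun c)

end EffectAlgebra

/-! Orthocompleteness makes `E` Archimedean, so each atom `a` has a largest multiple `m a`. By RDP
the interval below `m a` is the finite chain of multiples of `a`. Under RDP disjointness behaves as
in a Boolean algebra (`RDP.le_of_disjoint`). An atom `a` below `(m a)'` would give a larger
multiple, so `m a` and its supplement are disjoint, which makes `m a` central; distinct atoms have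
disjoint `m a`. For any `y`, the meets `y ∧ m a` are pairwise disjoint and so have a sum `x ≤ y`. A
nonzero remainder would contain an atom `a`, and `a` could be added to `y ∧ m a` inside both `y` and
`m a`, which is absurd. Hence `x = y`, and `y ↦ (y ∧ m a)` is an isomorphism onto the product of the
chains, from which the complete MV structure is transported. -/

namespace EffectAlgebra

/-! ### Cancellation and rearrangement of partial sums -/

section Order

variable {E : Type u} [EffectAlgebra E] {a b c d t u v w x y z : E}

theorem adds_assoc_symm {bc abc : E} (h : Adds b c bc) (h' : Adds a bc abc) :
    ∃ ab, Adds a b ab ∧ Adds ab c abc := by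
  obtain ⟨ab, h1, h2⟩ := adds_assoc (adds_comm h) (adds_comm h')
  exact ⟨ab, adds_comm h1, adds_comm h2⟩

theorem le_of_adds_left (h : Adds a b c) : a ≤ c := ⟨b, adds_comm h⟩

theorem le_of_adds_right (h : Adds a b c) : b ≤ c := ⟨a, h⟩

theorem eq_zero_of_le_zero (h : a ≤ 0) : a = 0 := le_bot_iff.1 h

theorem zero_le_all (a : E) : 0 ≤ a := (bot_le : ⊥ ≤ a)

theorem eq_zero_of_adds_self (h : Adds a b a) : b = 0 := adds_cancel h (adds_zero a)

theorem eq_zero_of_adds_of_le (h : Adds a b c) (hle : c ≤ a) : b = 0 := by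
  obtain rfl := le_antisymm (le_of_adds_left h) hle
  exact eq_zero_of_adds_self h

/-- Adding a fixed element on the left reflects the order. -/
theorem le_of_adds_le_adds_left (h : Adds a b c) (h' : Adds a x y) (hle : c ≤ y) : b ≤ x := by
  obtain ⟨d, hd⟩ := hle
  obtain ⟨e, he, he'⟩ := adds_assoc h (adds_comm hd)
  obtain rfl := adds_cancel he' h'
  exact le_of_adds_left he

/-- If `a + x` is defined and `b ≤ x`, then `a + b` is defined and below `a + x`. -/
theorem exists_adds_of_le_right (h : Adds a x y) (hle : b ≤ x) : ∃ c, Adds a b c ∧ c ≤ y := by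
  obtain ⟨d, hd⟩ := hle
  obtain ⟨c, hc, hc'⟩ := adds_assoc_symm (adds_comm hd) h
  exact ⟨c, hc, le_of_adds_left hc'⟩

/-- The interchange law for sums of four elements. -/
theorem adds_adds_adds_comm {q₁ q₂ r₁ r₂ : E} (h₁ : Adds q₁ r₁ a) (h₂ : Adds q₂ r₂ b)
    (h : Adds a b c) : ∃ q r, Adds q₁ q₂ q ∧ Adds r₁ r₂ r ∧ Adds q r c := by
  obtain ⟨s, hs, hs'⟩ := adds_assoc h₁ h
  obtain ⟨k, hk, hk'⟩ := adds_assoc_symm h₂ hs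
  obtain ⟨r, hr, hr'⟩ := adds_assoc (adds_comm hk) hk'
  obtain ⟨q, hq, hq'⟩ := adds_assoc_symm hr' hs'
  exact ⟨q, r, hq, hr, hq'⟩

end Order

/-! ### Riesz decomposition and disjointness -/

section Riesz

variable {E : Type u} [EffectAlgebra E] {a b c d t u v w x y z : E}

/-- Under RDP, an element below a sum is a sum of elements below the summands. -/
theorem RDP.exists_adds_of_le (hE : RDP E) (h : Adds u v t) (hw : w ≤ t) :
    ∃ w₁ w₂, w₁ ≤ u ∧ w₂ ≤ v ∧ Adds w₁ w₂ w := by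
  obtain ⟨d, hd⟩ := hw
  obtain ⟨c₁₁, c₁₂, c₂₁, c₂₂, h1, -, h3, h4⟩ := hE w d u v t (adds_comm hd) h
  exact ⟨c₁₁, c₁₂, le_of_adds_left h3, le_of_adds_left h4, h1⟩

/-- The part of `w` lying below `u` is below both, hence zero. Most later uses of RDP go through
this. -/
theorem RDP.le_of_disjoint (hE : RDP E) (h : Adds u v t) (hw : w ≤ t) (hd : Disjoint w u) :
    w ≤ v := by
  obtain ⟨w₁, w₂, h1, h2, h3⟩ := hE.exists_adds_of_le h hw
  have h0 : w₁ = 0 := eq_zero_of_le_zero (hd (le_of_adds_left h3) h1)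
  subst h0
  rwa [adds_unique h3 (zero_adds _)]

theorem RDP.disjoint_of_adds (hE : RDP E) (h : Adds u v t) (hu : Disjoint w u)
    (hv : Disjoint w v) : Disjoint w t := fun _ hxw hxt =>
  hv hxw (hE.le_of_disjoint h hxt (hu.mono_left hxw))

theorem RDP.exists_adds_of_disjoint (hE : RDP E) (hu : u ≤ y) (hv : v ≤ y)
    (hd : Disjoint u v) : ∃ t, Adds u v t ∧ t ≤ y := by
  obtain ⟨r, hr⟩ := hu
  exact exists_adds_of_le_right (adds_comm hr) (hE.le_of_disjoint (adds_comm hr) hv hd.symm)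

end Riesz

/-! ### Multiples, isotropic index and the Archimedean property -/

section Multiples

variable {E : Type u} [EffectAlgebra E] {a b c x y z : E}

theorem IsMultiple.unique {n : ℕ} (h : IsMultiple a n x) (h' : IsMultiple a n y) : x = y := by
  induction n generalizing x y with
  | zero => exact Eq.trans h (Eq.symm h')
  | succ n ih =>
    obtain ⟨u, hu, hx⟩ := h
    obtain ⟨v, hv, hy⟩ := h'
    obtain rfl := ih hu hv
    exact adds_unique hx hy

theorem isMultiple_one (a : E) : IsMultiple a 1 a := ⟨0, rfl, zero_adds a⟩

theorem IsMultiple.adds {k l : ℕ} (hx : IsMultiple a k x) (hy : IsMultiple a l y)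
    (h : Adds x y z) : IsMultiple a (k + l) z := by
  induction l generalizing y z with
  | zero =>
    obtain rfl : y = 0 := hy
    rwa [adds_unique h (adds_zero x)]
  | succ l ih =>
    obtain ⟨v, hv, hva⟩ := hy
    obtain ⟨s, hs, hs'⟩ := adds_assoc_symm hva h
    exact ⟨s, ih hv hs, hs'⟩

theorem IsMultiple.exists_le {n k : ℕ} (hx : IsMultiple a n x) (hk : k ≤ n) :
    ∃ y, IsMultiple a k y ∧ y ≤ x := by
  induction n generalizing x with
  | zero => obtain rfl : k = 0 := by omega
            exact ⟨x, hx, le_rfl⟩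
  | succ n ih =>
    rcases hk.eq_or_lt with rfl | hlt
    · exact ⟨x, hx, le_rfl⟩
    · obtain ⟨u, hu, hux⟩ := hx
      obtain ⟨y, hy, hyu⟩ := ih hu (by omega)
      exact ⟨y, hy, hyu.trans (le_of_adds_left hux)⟩

theorem IsMultiple.mono {k n : ℕ} (hx : IsMultiple a k x) (hy : IsMultiple a n y)
    (hk : k ≤ n) : x ≤ y := by
  obtain ⟨x', hx', hle⟩ := hy.exists_le hk
  rwa [hx.unique hx']

theorem IsMultiple.le_of_isotropicIndex_eq {n k : ℕ} (hn : isotropicIndex a = n)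
    (hx : IsMultiple a k x) : k ≤ n := by
  have : (k : ℕ∞) ≤ isotropicIndex a :=
    le_iSup₂ (f := fun (n : ℕ) (_ : n ∈ {n : ℕ | ∃ x, IsMultiple a n x}) => (n : ℕ∞)) k ⟨x, hx⟩
  rw [hn] at this
  exact_mod_cast this

theorem IsMultiple.isSumOver {ι : Type v} (s : Finset ι) (hx : IsMultiple a s.card x) :
    IsSumOver (fun _ : ι => a) s x := by
  induction s using Finset.cons_induction generalizing x with
  | empty =>
    obtain rfl : x = 0 := hx
    exact .empty
  | cons i s hi ih =>
    rw [Finset.card_cons] at hx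
    obtain ⟨u, hu, hux⟩ := hx
    exact .cons hi (ih hu) hux

theorem IsSumOver.isMultiple {ι : Type v} {s : Finset ι} (hx : IsSumOver (fun _ : ι => a) s x) :
    IsMultiple a s.card x := by
  induction hx with
  | empty => rfl
  | cons hi _ hux ih =>
    rw [Finset.card_cons]
    exact ⟨_, ih, hux⟩

/-- Orthocomplete effect algebras are Archimedean. -/
theorem IsOrthocomplete.eq_zero_of_forall_isMultiple (hE : IsOrthocomplete E)
    (h : ∀ n, ∃ x, IsMultiple a n x) : a = 0 := by
  -- The constant family; the lift puts its index type into the universe of `E`.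
  obtain ⟨x, -, hx⟩ := hE (ULift.{u} ℕ) (fun _ => a) fun s => by
    obtain ⟨x, hx⟩ := h s.card
    exact ⟨x, hx.isSumOver⟩
  have hle : ∀ n y, IsMultiple a n y → y ≤ x := fun n y hy => by
    let s : Finset (ULift.{u} ℕ) := (Finset.range n).map Equiv.ulift.symm.toEmbedding
    have hs : s.card = n := by simp [s]
    exact hx.1 ⟨s, IsMultiple.isSumOver s (hs.symm ▸ hy)⟩
  obtain ⟨r, hr⟩ := hle 1 a (isMultiple_one a)
  -- With `x = r + a`, cancelling `a` in `(k + 1) a ≤ x` gives `k a ≤ r`, so `r` already bounds all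
  -- finite sums.
  refine eq_zero_of_adds_of_le hr (hx.2 ?_)
  rintro y ⟨s, hs⟩
  obtain ⟨w, y', hy', hw⟩ := h (s.card + 1)
  obtain rfl := hy'.unique hs.isMultiple
  exact le_of_adds_le_adds_left (adds_comm hw) (adds_comm hr) (hle (s.card + 1) w ⟨y', hy', hw⟩)

theorem IsOrthocomplete.exists_isotropicIndex_eq (hE : IsOrthocomplete E) (ha : a ≠ 0) :
    ∃ (x : E) (n : ℕ), isotropicIndex a = n ∧ IsMultiple a n x := by
  classical
  have hex : ∃ n, ¬ ∃ x, IsMultiple a n x := by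
    by_contra! h
    exact ha (hE.eq_zero_of_forall_isMultiple h)
  obtain ⟨n, hn⟩ : ∃ n, Nat.find hex = n + 1 := Nat.exists_eq_succ_of_ne_zero fun h0 =>
    Nat.find_spec hex (h0 ▸ ⟨0, rfl⟩)
  obtain ⟨x, hx⟩ := not_not.1 (Nat.find_min hex (show n < Nat.find hex by omega))
  refine ⟨x, n, le_antisymm (iSup₂_le ?_) ?_, hx⟩
  · rintro k ⟨y, hy⟩
    by_contra! hlt
    have hlt : n < k := by exact_mod_cast hlt
    obtain ⟨w, hw, -⟩ := hy.exists_le (show Nat.find hex ≤ k by omega)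
    exact Nat.find_spec hex ⟨w, hw⟩
  · exact le_iSup₂ (f := fun (n : ℕ) (_ : n ∈ {n : ℕ | ∃ x, IsMultiple a n x}) => (n : ℕ∞)) n
      ⟨x, hx⟩

end Multiples

/-! ### Largest multiples of atoms: chains, centrality, atoms of the center -/

section AtomMultiples

variable {E : Type u} [EffectAlgebra E] {a b c x y z : E} {n : ℕ}

/-- Under RDP, the interval below a multiple of an atom consists of multiples of that atom. -/
theorem RDP.exists_isMultiple_of_le (hE : RDP E) (ha : IsAtom a) (hz : IsMultiple a n z)
    (hx : x ≤ z) : ∃ k ≤ n, IsMultiple a k x := by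
  induction n generalizing x z with
  | zero =>
    obtain rfl : z = 0 := hz
    exact ⟨0, le_rfl, eq_zero_of_le_zero hx⟩
  | succ n ih =>
    obtain ⟨u, hu, huz⟩ := hz
    obtain ⟨x₁, x₂, h1, h2, h⟩ := hE.exists_adds_of_le huz hx
    obtain ⟨k, hk, hkx⟩ := ih hu h1
    rcases ha.le_iff.1 h2 with h0 | rfl
    · obtain rfl : x₂ = 0 := h0
      rw [adds_unique h (adds_zero _)]
      exact ⟨k, by omega, hkx⟩
    · exact ⟨k + 1, by omega, _, hkx, h⟩

theorem RDP.atom_le_of_le_isMultiple (hE : RDP E) (ha : IsAtom a) (hz : IsMultiple a n z)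
    (hx : x ≤ z) (h0 : x ≠ 0) : a ≤ x := by
  obtain ⟨k, -, hkx⟩ := hE.exists_isMultiple_of_le ha hz hx
  cases k with
  | zero => exact absurd hkx h0
  | succ k => exact (isMultiple_one a).mono hkx (by omega)

theorem RDP.le_total_of_le_isMultiple (hE : RDP E) (ha : IsAtom a) (hz : IsMultiple a n z)
    (hx : x ≤ z) (hy : y ≤ z) : x ≤ y ∨ y ≤ x := by
  obtain ⟨k, -, hkx⟩ := hE.exists_isMultiple_of_le ha hz hx
  obtain ⟨l, -, hly⟩ := hE.exists_isMultiple_of_le ha hz hy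
  exact (le_total k l).imp (hkx.mono hly) (hly.mono hkx)

theorem RDP.disjoint_isMultiple (hE : RDP E) (ha : IsAtom a) (hz : IsMultiple a n z)
    (h : ¬ a ≤ x) : Disjoint z x := by
  intro w hwz hwx
  by_contra h0
  exact h ((hE.atom_le_of_le_isMultiple ha hz hwz fun h => h0 h.le).trans hwx)

theorem RDP.disjoint_isMultiple_of_ne (hE : RDP E) (ha : IsAtom a) (hb : IsAtom b) (hab : a ≠ b)
    {k : ℕ} (hx : IsMultiple a n x) (hy : IsMultiple b k y) : Disjoint x y := by
  refine hE.disjoint_isMultiple ha hx fun hle => hab ?_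
  have := hE.atom_le_of_le_isMultiple hb hy hle ha.1
  exact ((ha.le_iff.1 this).resolve_left hb.1).symm

theorem RDP.isPrincipal_isMultiple (hE : RDP E) (ha : IsAtom a) (hn : isotropicIndex a = n)
    (hz : IsMultiple a n z) : IsPrincipal z := by
  intro x y c hx hy h
  obtain ⟨k, -, hkx⟩ := hE.exists_isMultiple_of_le ha hz hx
  obtain ⟨l, -, hly⟩ := hE.exists_isMultiple_of_le ha hz hy
  have hc := hkx.adds hly h
  exact hc.mono hz (hc.le_of_isotropicIndex_eq hn)

theorem RDP.isCentral_isMultiple (hE : RDP E) (ha : IsAtom a) (hn : isotropicIndex a = n)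
    (hz : IsMultiple a n z) : IsCentral z := by
  obtain ⟨z', hz', -⟩ := exists_unique_orthosupplement z
  -- If `a ≤ z'`, then `z + a` is an `(n + 1)`-st multiple, beyond the index.
  have hd : Disjoint z z' := hE.disjoint_isMultiple ha hz fun hle => by
    obtain ⟨c, hc, -⟩ := exists_adds_of_le_right hz' hle
    have hc' : IsMultiple a (n + 1) c := ⟨z, hz, hc⟩
    have := hc'.le_of_isotropicIndex_eq hn
    omega
  refine ⟨hE.isPrincipal_isMultiple ha hn hz, z', hz', fun x y c hx hy h => ?_, fun p => ?_⟩
  · exact hE.le_of_disjoint hz' le_top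
      (hE.disjoint_of_adds h (hd.mono_right hx) (hd.mono_right hy)).symm
  · exact hE.exists_adds_of_le hz' le_top

theorem RDP.isAtom_isMultiple_center (hE : RDP E) (ha : IsAtom a) (hn : isotropicIndex a = n)
    (hz : IsMultiple a n z) (hc : z ∈ center E) : IsAtom (⟨z, hc⟩ : center E) := by
  have haz : a ≤ z := (isMultiple_one a).mono hz ((isMultiple_one a).le_of_isotropicIndex_eq hn)
  refine ⟨fun h => ha.1 (le_bot_iff.1 (haz.trans (congrArg Subtype.val h).le)), ?_⟩
  rintro ⟨w, hw⟩ hlt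
  have hwz : w < z := hlt
  by_contra h0
  have haw : a ≤ w := hE.atom_le_of_le_isMultiple ha hz hwz.le fun h => h0 (Subtype.ext h)
  -- If `0 < w < z`, then `a` lies below both `w` and `z - w`; so `w + a` exists, and principality
  -- of `w` forces `w + a ≤ w`.
  obtain ⟨r, hr⟩ := hwz.le
  have hr0 : r ≠ 0 := by
    rintro rfl
    exact hwz.ne (adds_unique (zero_adds w) hr)
  have har : a ≤ r := hE.atom_le_of_le_isMultiple ha hz (le_of_adds_left hr) hr0
  obtain ⟨c, hc', -⟩ := exists_adds_of_le_right (adds_comm hr) har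
  exact ha.1 (eq_zero_of_adds_of_le hc' (hw.1 w a c le_rfl haw hc'))

end AtomMultiples

/-! ### Sums of pairwise disjoint families -/

section DisjointFamilies

variable {E : Type u} [EffectAlgebra E] {ι : Type v} {x : ι → E} {y t : E}

theorem isSumOver_singleton (x : ι → E) (i : ι) : IsSumOver x {i} (x i) :=
  .cons (Finset.notMem_empty i) .empty (zero_adds (x i))

/-- The disjointness clause carries the induction: it lets the next member be added to the partial
sum without leaving `y`. -/
theorem RDP.isSumOver_le (hE : RDP E) (hd : Pairwise fun i j => Disjoint (x i) (x j))
    (hy : ∀ i, x i ≤ y) {s : Finset ι} (h : IsSumOver x s t) :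
    t ≤ y ∧ ∀ j ∉ s, Disjoint (x j) t := by
  induction h with
  | empty => exact ⟨zero_le_all y, fun j _ => (disjoint_bot_right : Disjoint (x j) ⊥)⟩
  | @cons i s t t' hi _ h ih =>
    obtain ⟨c, hc, hcy⟩ := hE.exists_adds_of_disjoint ih.1 (hy i) (ih.2 i hi).symm
    obtain rfl := adds_unique hc h
    refine ⟨hcy, fun j hj => ?_⟩
    rw [Finset.mem_cons, not_or] at hj
    exact hE.disjoint_of_adds h (ih.2 j hj.2) (hd hj.1)

theorem RDP.isOrthogonal_of_disjoint (hE : RDP E)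
    (hd : Pairwise fun i j => Disjoint (x i) (x j)) : IsOrthogonal x := by
  intro s
  induction s using Finset.cons_induction with
  | empty => exact ⟨0, .empty⟩
  | cons i s hi ih =>
    obtain ⟨t, ht⟩ := ih
    obtain ⟨c, hc, -⟩ := hE.exists_adds_of_disjoint (y := 1) le_top le_top
      ((hE.isSumOver_le (y := 1) hd (fun _ => le_top) ht).2 i hi).symm
    exact ⟨c, .cons hi ht hc⟩

theorem IsSystemSum.le (h : IsSystemSum x y) (i : ι) : x i ≤ y :=
  h.2.1 ⟨{i}, isSumOver_singleton x i⟩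

theorem RDP.isSystemSum_le (hE : RDP E) (hd : Pairwise fun i j => Disjoint (x i) (x j))
    (h : IsSystemSum x t) (hy : ∀ i, x i ≤ y) : t ≤ y :=
  h.2.2 fun _ ⟨_, hs⟩ => (hE.isSumOver_le hd hy hs).1

end DisjointFamilies

/-! ### Meets with central elements and the product decomposition -/

section CentralMeets

variable {E : Type u} [EffectAlgebra E] {p q r y z z' : E}

theorem IsPrincipal.disjoint_orthosupplement (hz : IsPrincipal z) (h : Adds z z' 1) :
    Disjoint z z' := by
  intro w hw hw'
  obtain ⟨c, hc, -⟩ := exists_adds_of_le_right h hw'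
  exact (eq_zero_of_adds_of_le hc (hz z w c le_rfl hw hc)).le

theorem RDP.isGLB_of_adds (hE : RDP E) (hd : Disjoint z z') (hq : q ≤ z) (hr : r ≤ z')
    (h : Adds q r p) : IsGLB {p, z} q := by
  refine ⟨by simpa using ⟨le_of_adds_left h, hq⟩, fun w hw => ?_⟩
  have hwp : w ≤ p := hw (by simp)
  have hwz : w ≤ z := hw (by simp)
  exact hE.le_of_disjoint (adds_comm h) hwp (hd.mono hwz hr)

theorem RDP.exists_isGLB_of_isCentral (hE : RDP E) (hz : IsCentral z) (p : E) :
    ∃ q, IsGLB {p, z} q := by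
  obtain ⟨h1, z', hz', -, h⟩ := hz
  obtain ⟨q, r, hq, hr, hqr⟩ := h p
  exact ⟨q, hE.isGLB_of_adds (h1.disjoint_orthosupplement hz') hq hr hqr⟩

/-- Under RDP, taking meets with a central element is additive. -/
theorem RDP.adds_of_isGLB (hE : RDP E) (hz : IsCentral z) {a b c a₁ b₁ c₁ : E}
    (ha : IsGLB {a, z} a₁) (hb : IsGLB {b, z} b₁) (hc : IsGLB {c, z} c₁) (h : Adds a b c) :
    Adds a₁ b₁ c₁ := by
  obtain ⟨h1, z', hz', h2, hdec⟩ := hz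
  have hd := h1.disjoint_orthosupplement hz'
  obtain ⟨qa, ra, hqa, hra, hqra⟩ := hdec a
  obtain ⟨qb, rb, hqb, hrb, hqrb⟩ := hdec b
  obtain rfl := (hE.isGLB_of_adds hd hqa hra hqra).unique ha
  obtain rfl := (hE.isGLB_of_adds hd hqb hrb hqrb).unique hb
  -- Both `z` and `z'` are principal, so the regrouped parts of `c` stay below them and `q` is the
  -- meet of `c` with `z`.
  obtain ⟨q, r, hq, hr, hqr⟩ := adds_adds_adds_comm hqra hqrb h
  obtain rfl := (hE.isGLB_of_adds hd (h1 _ _ q hqa hqb hq) (h2 _ _ r hra hrb hr) hqr).unique hc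
  exact hq

/-- The sum of a family lying below pairwise disjoint central elements has the members of the
family as its meets with these central elements. -/
theorem RDP.isGLB_of_isSystemSum {ι : Type v} (hE : RDP E) {m x : ι → E}
    (hm : ∀ i, IsCentral (m i)) (hd : Pairwise fun i j => Disjoint (m i) (m j))
    (hx : ∀ i, x i ≤ m i) (hy : IsSystemSum x y) (i : ι) : IsGLB {y, m i} (x i) := by
  refine ⟨by simpa using ⟨hy.le i, hx i⟩, fun w hw => ?_⟩
  have hwy : w ≤ y := hw (by simp)
  have hwm : w ≤ m i := hw (by simp)
  obtain ⟨h1, z', hz', -, -⟩ := hm i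
  -- The bound `t = z' + x i` dominates the whole family, since `m j ≤ z'` for `j ≠ i`; as `w` is
  -- disjoint from `z'`, only `x i` remains above it.
  obtain ⟨t, ht, -⟩ := exists_adds_of_le_right (adds_comm hz') (hx i)
  have hyt : y ≤ t := by
    refine hE.isSystemSum_le (fun j k hjk => (hd hjk).mono (hx j) (hx k)) hy fun j => ?_
    by_cases hji : j = i
    · subst hji
      exact le_of_adds_right ht
    · exact ((hx j).trans (hE.le_of_disjoint hz' le_top (hd hji))).trans (le_of_adds_left ht)
  exact hE.le_of_disjoint ht (hwy.trans hyt)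
    ((h1.disjoint_orthosupplement hz').mono_left hwm)

/-- If every element is the sum of its meets with pairwise disjoint central elements, then the
effect algebra is the product of the intervals below these elements. -/
theorem RDP.nonempty_iso_product {ι : Type u} (hE : RDP E) (hoc : IsOrthocomplete E) {m : ι → E}
    (hm : ∀ i, IsCentral (m i)) (hd : Pairwise fun i j => Disjoint (m i) (m j))
    (hsum : ∀ (y : E) (p : ι → E), (∀ i, IsGLB {y, m i} (p i)) → IsSystemSum p y) :
    Nonempty (Iso E (Product fun i => Interval (m i))) := by
  choose φ hφ using fun (y : E) (i : ι) => hE.exists_isGLB_of_isCentral (hm i) y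
  have hφm : ∀ y i, φ y i ≤ m i := fun y i => (hφ y i).1 (by simp)
  have hφy : ∀ y i, φ y i ≤ y := fun y i => (hφ y i).1 (by simp)
  have hdφ : ∀ y, Pairwise fun i j => Disjoint (φ y i) (φ y j) := fun y i j hij =>
    (hd hij).mono (hφm y i) (hφm y j)
  have hle : ∀ a b, (∀ i, φ a i ≤ φ b i) → a ≤ b := fun a b h =>
    hE.isSystemSum_le (hdφ a) (hsum a _ (hφ a)) fun i => (h i).trans (hφy b i)
  have hinj : ∀ a b, (∀ i, φ a i = φ b i) → a = b := fun a b h =>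
    le_antisymm (hle a b fun i => (h i).le) (hle b a fun i => (h i).ge)
  let f : E → Product fun i => Interval (m i) := fun y i => ⟨φ y i, hφm y i⟩
  have hf : Function.Bijective f := by
    refine ⟨fun a b h => hinj a b fun i => congrArg Subtype.val (congrFun h i), fun x => ?_⟩
    have hx : ∀ i, (x i).1 ≤ m i := fun i => (x i).2
    obtain ⟨y, hy⟩ := hoc ι (fun i => (x i).1)
      (hE.isOrthogonal_of_disjoint fun i j hij => (hd hij).mono (hx i) (hx j))
    exact ⟨y, funext fun i => Subtype.ext
      ((hφ y i).unique (hE.isGLB_of_isSystemSum hm hd hx hy i))⟩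
  refine ⟨⟨Equiv.ofBijective f hf, funext fun i => Subtype.ext ?_,
    funext fun i => Subtype.ext ?_, fun a b c => ⟨fun h i => ?_, fun h => ?_⟩⟩⟩
  · exact eq_zero_of_le_zero (hφy 0 i)
  · have hmem : m i ∈ lowerBounds {1, m i} := by
      rintro w (rfl | rfl)
      exacts [(le_top : m i ≤ ⊤), le_rfl]
    exact le_antisymm (hφm 1 i) ((hφ 1 i).2 hmem)
  · exact hE.adds_of_isGLB (hm i) (hφ a i) (hφ b i) (hφ c i) h
  · have h : ∀ i, Adds (φ a i) (φ b i) (φ c i) := h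
    -- The difference `d` of `c` and `a` has the same meets as `b`, by cancellation in each
    -- coordinate.
    obtain ⟨d, hd⟩ := hle a c fun i => le_of_adds_left (h i)
    have hd := adds_comm hd
    obtain rfl : d = b := hinj d b fun i =>
      adds_cancel (hE.adds_of_isGLB (hm i) (hφ a i) (hφ d i) (hφ c i) hd) (h i)
    exact hd

end CentralMeets

/-! ### Complete MV structure on chains, products and isomorphic copies -/

section CompleteMV

/-- Suprema of all subsets and compatibility of all pairs suffice for a complete MV-effect
algebra. -/
theorem isCompleteMVEffectAlgebra_of {E : Type u} [EffectAlgebra E]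
    (hsup : ∀ S : Set E, ∃ x, IsLUB S x) (hcomp : ∀ a b : E, Compatible a b) :
    IsCompleteMVEffectAlgebra E := by
  have hinf : ∀ S : Set E, ∃ x, IsGLB S x := fun S =>
    (hsup (lowerBounds S)).imp fun _ => isLUB_lowerBounds.1
  exact ⟨⟨fun a b => ⟨hsup _, hinf _⟩, hcomp⟩, fun S => ⟨hsup S, hinf S⟩⟩

theorem compatible_of_le {E : Type u} [EffectAlgebra E] {a b : E} (h : a ≤ b) :
    Compatible a b := by
  obtain ⟨d, hd⟩ := h
  exact ⟨0, d, a, zero_adds a, hd, d, b, zero_adds d, hd⟩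

theorem Compatible.symm {E : Type u} [EffectAlgebra E] {a b : E} (h : Compatible a b) :
    Compatible b a := by
  obtain ⟨a₁, b₁, c, h1, h2, t, s, h3, h4⟩ := h
  exact ⟨b₁, a₁, c, h2, h1, t, s, adds_comm h3, h4⟩

theorem Interval.le_iff {E : Type u} [EffectAlgebra E] {e : E} {x y : Interval e} :
    x ≤ y ↔ x.1 ≤ y.1 :=
  ⟨fun ⟨c, hc⟩ => ⟨c.1, hc⟩, fun ⟨c, hc⟩ => ⟨⟨c, (le_of_adds_left hc).trans y.2⟩, hc⟩⟩

/-- The interval is a finite chain: a maximal member of a nonempty subset is its greatest, and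
comparable elements are compatible. -/
theorem RDP.isCompleteMVEffectAlgebra_interval {E : Type u} [EffectAlgebra E] (hE : RDP E)
    {a z : E} {n : ℕ} (ha : IsAtom a) (hz : IsMultiple a n z) :
    IsCompleteMVEffectAlgebra (Interval z) := by
  have htot : ∀ x y : Interval z, x ≤ y ∨ y ≤ x := fun x y => by
    simpa only [Interval.le_iff] using hE.le_total_of_le_isMultiple ha hz x.2 y.2
  have hfin : Finite (Interval z) := by
    choose k hk hkx using fun x : Interval z => hE.exists_isMultiple_of_le ha hz x.2
    refine Finite.of_injective (fun x => (⟨k x, Nat.lt_succ_of_le (hk x)⟩ : Fin (n + 1))) ?_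
    intro x y hxy
    have h : k x = k y := congrArg Fin.val hxy
    exact Subtype.ext ((hkx x).unique (h ▸ hkx y))
  refine isCompleteMVEffectAlgebra_of (fun S => ?_) fun x y =>
    (htot x y).elim compatible_of_le fun h => (compatible_of_le h).symm
  rcases S.eq_empty_or_nonempty with rfl | hS
  · exact ⟨⊥, isLUB_empty⟩
  · obtain ⟨g, hg⟩ := S.toFinite.exists_maximal hS
    refine ⟨g, fun x hx => ?_, fun u hu => hu hg.1⟩
    exact (htot x g).elim id fun h => hg.2 hx h

theorem Product.le_iff {ι : Type v} {F : ι → Type u} [∀ i, EffectAlgebra (F i)]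
    {x y : Product F} : x ≤ y ↔ ∀ i, x i ≤ y i := by
  refine ⟨fun ⟨c, hc⟩ i => ⟨c i, hc i⟩, fun h => ?_⟩
  choose c hc using h
  exact ⟨c, hc⟩

theorem isCompleteMVEffectAlgebra_product {ι : Type v} {F : ι → Type u}
    [∀ i, EffectAlgebra (F i)] (hF : ∀ i, IsCompleteMVEffectAlgebra (F i)) :
    IsCompleteMVEffectAlgebra (Product F) := by
  refine isCompleteMVEffectAlgebra_of (fun S => ?_) fun a b => ?_
  · choose g hg using fun i => ((hF i).2 ((fun x : Product F => x i) '' S)).1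
    refine ⟨g, fun x hx => Product.le_iff.2 fun i => (hg i).1 ⟨x, hx, rfl⟩, fun u hu =>
      Product.le_iff.2 fun i => (hg i).2 ?_⟩
    rintro _ ⟨x, hx, rfl⟩
    exact Product.le_iff.1 (hu hx) i
  · choose a₁ b₁ c h1 h2 t s h3 h4 using fun i => (hF i).1.2 (a i) (b i)
    exact ⟨a₁, b₁, c, h1, h2, t, s, h3, h4⟩

theorem Iso.le_iff {E : Type u} {F : Type v} [EffectAlgebra E] [EffectAlgebra F] (e : Iso E F)
    {x y : E} : e.toEquiv x ≤ e.toEquiv y ↔ x ≤ y := by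
  constructor
  · rintro ⟨c, hc⟩
    refine ⟨e.toEquiv.symm c, (e.map_adds _ _ _).2 ?_⟩
    simpa using hc
  · rintro ⟨c, hc⟩
    exact ⟨_, (e.map_adds _ _ _).1 hc⟩

theorem Iso.isCompleteMVEffectAlgebra {E : Type u} {F : Type v} [EffectAlgebra E]
    [EffectAlgebra F] (e : Iso E F) (hF : IsCompleteMVEffectAlgebra F) :
    IsCompleteMVEffectAlgebra E := by
  let o : E ≃o F := ⟨e.toEquiv, e.le_iff⟩
  refine isCompleteMVEffectAlgebra_of (fun S => ?_) fun a b => ?_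
  · obtain ⟨x, hx⟩ := (hF.2 (o '' S)).1
    exact ⟨o.symm x, o.isLUB_image.1 hx⟩
  · obtain ⟨a₁, b₁, c, h1, h2, t, s, h3, h4⟩ := hF.1.2 (e.toEquiv a) (e.toEquiv b)
    have hs : ∀ {x y w : F}, Adds x y w →
        Adds (e.toEquiv.symm x) (e.toEquiv.symm y) (e.toEquiv.symm w) := fun {x y w} h =>
      (e.map_adds _ _ _).2 (by simpa using h)
    exact ⟨e.toEquiv.symm a₁, e.toEquiv.symm b₁, e.toEquiv.symm c, by simpa using hs h1,
      by simpa using hs h2, _, _, hs h3, hs h4⟩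

end CompleteMV

/-- In an atomic orthocomplete effect algebra with RDP, every element is the sum of its meets with
pairwise disjoint principal elements which dominate all atoms. -/
theorem RDP.isSystemSum_of_isGLB {E : Type u} [EffectAlgebra E] (hE : RDP E)
    (hoc : IsOrthocomplete E) (hat : IsAtomic E) {ι : Type u} {m p : ι → E}
    (hm : ∀ i, IsPrincipal (m i)) (hd : Pairwise fun i j => Disjoint (m i) (m j))
    (hatom : ∀ a : E, IsAtom a → ∃ i, a ≤ m i) {y : E} (hp : ∀ i, IsGLB {y, m i} (p i)) :
    IsSystemSum p y := by
  have hpm : ∀ i, p i ≤ m i := fun i => (hp i).1 (by simp)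
  have hpy : ∀ i, p i ≤ y := fun i => (hp i).1 (by simp)
  have hdp : Pairwise fun i j => Disjoint (p i) (p j) := fun i j hij =>
    (hd hij).mono (hpm i) (hpm j)
  obtain ⟨x, hx⟩ := hoc ι p (hE.isOrthogonal_of_disjoint hdp)
  have hxy := hE.isSystemSum_le hdp hx hpy
  obtain ⟨r, hr⟩ := hxy
  rcases eq_bot_or_exists_atom_le r with h0 | ⟨a, ha, har⟩
  · obtain rfl : r = 0 := h0
    rwa [← adds_unique (zero_adds x) hr]
  · exfalso
    obtain ⟨i, hi⟩ := hatom a ha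
    -- Since `p i ≤ x`, the sum `p i + a` exists below `x + a ≤ y`, and below `m i` by principality.
    -- So it is below the meet `p i`, forcing `a = 0`.
    obtain ⟨s, hs, hsy⟩ := exists_adds_of_le_right (adds_comm hr) har
    obtain ⟨t, ht, hts⟩ := exists_adds_of_le_right (adds_comm hs) (hx.le i)
    have ht := adds_comm ht
    refine ha.1 (eq_zero_of_adds_of_le ht ((hp i).2 ?_))
    simpa using ⟨hts.trans hsy, hm i _ _ _ (hpm i) hi ht⟩

end EffectAlgebra

theorem theorem4p13 {E : Type u} [EffectAlgebra E] (hcomplete : EffectAlgebra.IsOrthocomplete E)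
    (hatomic : IsAtomic E) (hRDP : EffectAlgebra.RDP E) :
    -- `m a` is the multiple of the atom `a` by its (finite) isotropic index
    ∃ m : {a : E // IsAtom a} → E,
      (∀ a, ∃ n : ℕ, EffectAlgebra.isotropicIndex a.1 = n ∧
        EffectAlgebra.IsMultiple a.1 n (m a)) ∧
      (∀ a, EffectAlgebra.IsCentral (m a)) ∧
      (∀ a, ∃ h : m a ∈ EffectAlgebra.center E,
        IsAtom (⟨m a, h⟩ : EffectAlgebra.center E)) ∧
      (∀ y : E, ∃ p : {a : E // IsAtom a} → E,
        (∀ a, IsGLB {y, m a} (p a)) ∧ EffectAlgebra.IsSystemSum p y) ∧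
      Nonempty (EffectAlgebra.Iso E
        (EffectAlgebra.Product fun a : {a : E // IsAtom a} => EffectAlgebra.Interval (m a))) ∧
      EffectAlgebra.IsCompleteMVEffectAlgebra E := by

  choose m n hn hm using fun a : {a : E // IsAtom a} =>
    hcomplete.exists_isotropicIndex_eq (show a.1 ≠ 0 from a.2.1)
  have hcent : ∀ a, EffectAlgebra.IsCentral (m a) := fun a =>
    hRDP.isCentral_isMultiple a.2 (hn a) (hm a)
  have hd : Pairwise fun a b => Disjoint (m a) (m b) := fun a b hab =>
    hRDP.disjoint_isMultiple_of_ne a.2 b.2 (fun h => hab (Subtype.ext h)) (hm a) (hm b)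
  have hle : ∀ a, a.1 ≤ m a := fun a =>
    (EffectAlgebra.isMultiple_one a.1).mono (hm a)
      ((EffectAlgebra.isMultiple_one a.1).le_of_isotropicIndex_eq (hn a))
  have hsum : ∀ (y : E) (p : {a : E // IsAtom a} → E), (∀ a, IsGLB {y, m a} (p a)) →
      EffectAlgebra.IsSystemSum p y := fun y p hp =>
    hRDP.isSystemSum_of_isGLB hcomplete hatomic (fun a => (hcent a).1) hd
      (fun a ha => ⟨⟨a, ha⟩, hle ⟨a, ha⟩⟩) hp
  have hiso := hRDP.nonempty_iso_product hcomplete hcent hd hsum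
  refine ⟨m, fun a => ⟨n a, hn a, hm a⟩, hcent, fun a => ⟨hcent a,
    hRDP.isAtom_isMultiple_center a.2 (hn a) (hm a) (hcent a)⟩, fun y => ?_, hiso,
    hiso.some.isCompleteMVEffectAlgebra (EffectAlgebra.isCompleteMVEffectAlgebra_product fun a =>
      hRDP.isCompleteMVEffectAlgebra_interval a.2 (hm a))⟩
  choose p hp using fun a => hRDP.exists_isGLB_of_isCentral (hcent a) y
  exact ⟨p, hp, hsum y p hp⟩
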